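/- Let $\mathcal H$ be an infinite-dimensional separable complex Hilbert space, and let $\mathrm U(\mathcal H)$ be the group of all unitary operators on $\mathcal H$. Equip $\mathrm U(\mathcal H)$ with the strong operator topology, i.e. the coarsest topology for which all the evaluation maps $\mathrm U(\mathcal H)\to\mathcal H$, $T\mapsto Tf$ $(f\in\mathcal H)$, are continuous, where $\mathcal H$ carries its norm topology. Then $\mathrm U(\mathcal H)$ is contractible. -/

import Mathlib

/-- The unitary group `U(H)` of a complex Hilbert space `H`: the bounded operators `T` on `H` with
`T* T = T T* = 1`. This is a type synonym, so that it does not carry the norm topology; its topology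
is the strong operator topology, given below. -/
def StrongUnitaryGroup (H : Type*) [NormedAddCommGroup H] [InnerProductSpace ℂ H]
    [CompleteSpace H] : Type _ :=
  unitary (H →L[ℂ] H)

namespace StrongUnitaryGroup

noncomputable instance instGroup (H : Type*) [NormedAddCommGroup H] [InnerProductSpace ℂ H] [CompleteSpace H] :
    Group (StrongUnitaryGroup H) :=
  inferInstanceAs (Group (unitary (H →L[ℂ] H)))

/-- A unitary operator as an element of the space of bounded operators on `H` with the strong
operator topology (the topology of pointwise convergence in the norm of `H`). -/
noncomputable def toPointwise {H : Type*} [NormedAddCommGroup H] [InnerProductSpace ℂ H] [CompleteSpace H]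
    (U : StrongUnitaryGroup H) : H →Lₚₜ[ℂ] H :=
  ContinuousLinearMap.toPointwiseConvergenceCLM ℂ (RingHom.id ℂ) H H (Subtype.val U)

/-- The strong topology on `U(H)`: the subspace topology from the bounded operators with the
strong operator topology. -/
noncomputable instance instTopologicalSpace (H : Type*) [NormedAddCommGroup H] [InnerProductSpace ℂ H]
    [CompleteSpace H] : TopologicalSpace (StrongUnitaryGroup H) :=
  TopologicalSpace.induced toPointwise inferInstance

end StrongUnitaryGroup

/-! For an isometry `W`, let a unitary `U` act as `W U W*` on the range of `W` and as the identity
on its complement. If `W s` starts at `1`, varies strongly continuously together with its adjoint,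
and `star (W s) → 0` strongly, these unitaries run from `U` to `1` as `s → ∞`: their distance from
the identity on `f` is at most `2 * ‖star (W s) f‖` (`norm_conjExtend_sub_le`). Right translations
on `L²(0, ∞)` form such a family, and `H` is isometric to that space, both having a countably
infinite Hilbert basis. -/

open Filter Topology MeasureTheory
open scoped NNReal ENNReal InnerProductSpace

/-! ### Contraction along a family of isometries -/

namespace StrongUnitaryGroup

variable {H : Type*} [NormedAddCommGroup H] [InnerProductSpace ℂ H] [CompleteSpace H]

/-- The bounded operator underlying a unitary operator. -/
def toCLM (U : StrongUnitaryGroup H) : H →L[ℂ] H := Subtype.val U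

theorem star_toCLM_mul_self (U : StrongUnitaryGroup H) : star U.toCLM * U.toCLM = 1 :=
  (Unitary.mem_iff.1 U.2).1

theorem toCLM_mul_star_self (U : StrongUnitaryGroup H) : U.toCLM * star U.toCLM = 1 :=
  (Unitary.mem_iff.1 U.2).2

theorem isInducing_toCLM :
    IsInducing fun (U : StrongUnitaryGroup H) (f : H) => U.toCLM f :=
  (PointwiseConvergenceCLM.isEmbedding_coeFn (RingHom.id ℂ) H H).isInducing.comp ⟨rfl⟩

theorem continuousAt_iff {X : Type*} [TopologicalSpace X] {g : X → StrongUnitaryGroup H} {x : X} :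
    ContinuousAt g x ↔ ∀ f, ContinuousAt (fun y => (g y).toCLM f) x := by
  rw [isInducing_toCLM.continuousAt_iff, continuousAt_pi]
  rfl

theorem norm_toCLM_apply (U : StrongUnitaryGroup H) (f : H) : ‖U.toCLM f‖ = ‖f‖ :=
  (ContinuousLinearMap.norm_map_iff_adjoint_comp_self U.toCLM).2 U.star_toCLM_mul_self f

/-- Unitaries are 1-Lipschitz, so continuity in each variable gives joint continuity. -/
theorem continuous_eval : Continuous fun p : StrongUnitaryGroup H × H => p.1.toCLM p.2 := by
  refine continuous_prod_of_continuous_lipschitzWith' _ 1 (fun U => ?_) fun f => ?_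
  · refine LipschitzWith.of_dist_le_mul fun f g => ?_
    rw [dist_eq_norm, dist_eq_norm, ← map_sub, norm_toCLM_apply]; simp
  · exact (continuous_apply f).comp isInducing_toCLM.continuous

/-- The unitary operator that acts as `U` on the range of the isometry `W` (identified with `H`
through `W`) and as the identity on the orthogonal complement of that range. -/
noncomputable def conjExtend (W : H →L[ℂ] H) (hW : star W * W = 1) (U : StrongUnitaryGroup H) :
    StrongUnitaryGroup H :=
  ⟨W * U.toCLM * star W + (1 - W * star W), by
    have h (x : H →L[ℂ] H) : star W * (W * x) = x := by rw [← mul_assoc, hW, one_mul]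
    have h1 (x : H →L[ℂ] H) : star U.toCLM * (U.toCLM * x) = x := by
      rw [← mul_assoc, star_toCLM_mul_self, one_mul]
    have h2 (x : H →L[ℂ] H) : U.toCLM * (star U.toCLM * x) = x := by
      rw [← mul_assoc, toCLM_mul_star_self, one_mul]
    rw [Unitary.mem_iff]
    constructor <;>
    · simp only [star_add, star_mul, star_sub, star_one, star_star, mul_add, add_mul, mul_sub,
        sub_mul, mul_assoc, one_mul, mul_one, h, h1, h2]
      abel⟩

theorem conjExtend_apply (W : H →L[ℂ] H) (hW : star W * W = 1) (U : StrongUnitaryGroup H) (f : H) :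
    (conjExtend W hW U).toCLM f = W (U.toCLM (star W f)) + (f - W (star W f)) := rfl

theorem conjExtend_one (hW : star (1 : H →L[ℂ] H) * 1 = 1) (U : StrongUnitaryGroup H) :
    conjExtend 1 hW U = U :=
  Subtype.ext (show 1 * U.toCLM * star 1 + (1 - 1 * star 1) = U.toCLM by simp)

theorem norm_apply_of_star_mul_self {W : H →L[ℂ] H} (hW : star W * W = 1) (f : H) : ‖W f‖ = ‖f‖ :=
  (ContinuousLinearMap.norm_map_iff_adjoint_comp_self W).2 hW f

/-- The bound does not involve `U`, which gives joint continuity at the end `s = ∞` of the homotopy.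
-/
theorem norm_conjExtend_sub_le (W : H →L[ℂ] H) (hW : star W * W = 1) (U : StrongUnitaryGroup H)
    (f : H) : ‖(conjExtend W hW U).toCLM f - f‖ ≤ 2 * ‖star W f‖ := by
  have h : (conjExtend W hW U).toCLM f - f = W (U.toCLM (star W f)) - W (star W f) := by
    rw [conjExtend_apply]; abel
  rw [h, two_mul]
  refine (norm_sub_le _ _).trans_eq ?_
  rw [norm_apply_of_star_mul_self hW, norm_apply_of_star_mul_self hW, norm_toCLM_apply]

/-- A strongly continuous family of isometries, starting at the identity, whose adjoints tend
strongly to zero, contracts the unitary group. -/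
theorem contractibleSpace_of_isometries (W : ℝ≥0 → H →L[ℂ] H) (hW : ∀ s, star (W s) * W s = 1)
    (h0 : W 0 = 1) (hc : ∀ f, Continuous fun s => W s f)
    (hc' : ∀ f, Continuous fun s => star (W s) f)
    (hlim : ∀ f, Tendsto (fun s => star (W s) f) atTop (𝓝 0)) :
    ContractibleSpace (StrongUnitaryGroup H) := by
  classical
  have hWc : Continuous fun p : ℝ≥0 × H => W p.1 p.2 := by
    refine continuous_prod_of_continuous_lipschitzWith' _ 1 (fun s => ?_) hc
    refine LipschitzWith.of_dist_le_mul fun f g => ?_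
    rw [dist_eq_norm, dist_eq_norm, ← map_sub, norm_apply_of_star_mul_self (hW s)]; simp
  have hG : Continuous fun p : ℝ≥0 × StrongUnitaryGroup H =>
      conjExtend (W p.1) (hW p.1) p.2 := by
    rw [continuous_iff_continuousAt]
    refine fun p => continuousAt_iff.2 fun f => Continuous.continuousAt ?_
    simp only [conjExtend_apply]
    have h1 : Continuous fun p : ℝ≥0 × StrongUnitaryGroup H => star (W p.1) f :=
      (hc' f).comp continuous_fst
    exact (hWc.comp (continuous_fst.prodMk
      (continuous_eval.comp (continuous_snd.prodMk h1)))).add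
      (continuous_const.sub (hWc.comp (continuous_fst.prodMk h1)))
  -- Time `t = 1` corresponds to `s = 0`, and `t → 0` to `s → ∞`.
  let σ : unitInterval → ℝ≥0 := fun t => ((t : ℝ)⁻¹ - 1).toNNReal
  let F : unitInterval × StrongUnitaryGroup H → StrongUnitaryGroup H := fun p =>
    if p.1 = 0 then 1 else conjExtend (W (σ p.1)) (hW _) p.2
  have hF : Continuous F := by
    rw [continuous_iff_continuousAt]
    rintro ⟨t, U⟩
    by_cases ht : t = 0
    · subst ht
      refine continuousAt_iff.2 fun f => ?_
      have hF0 : (F (0, U)).toCLM f = f := by simp only [F, if_true]; rfl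
      rw [ContinuousAt, hF0, tendsto_iff_norm_sub_tendsto_zero]
      let B : unitInterval → ℝ := fun t => if t = 0 then 0 else 2 * ‖star (W (σ t)) f‖
      have hB : Tendsto B (𝓝 0) (𝓝 0) := by
        have hB0 : B 0 = 0 := if_pos rfl
        rw [← hB0]
        refine continuousAt_iff_punctured_nhds.2 ?_
        rw [hB0]
        have hσ : Tendsto σ (𝓝[≠] 0) atTop := by
          refine tendsto_real_toNNReal_atTop.comp (tendsto_atTop_add_const_right _ _ ?_)
          refine tendsto_inv_nhdsGT_zero.comp ?_
          refine tendsto_nhdsWithin_iff.2 ⟨?_, ?_⟩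
          · exact (continuous_subtype_val.tendsto (0 : unitInterval)).mono_left nhdsWithin_le_nhds
          · filter_upwards [self_mem_nhdsWithin] with t ht
            exact unitInterval.pos_iff_ne_zero.2 ht
        have := (((hlim f).comp hσ).norm).const_mul 2
        rw [norm_zero, mul_zero] at this
        refine this.congr' ?_
        filter_upwards [self_mem_nhdsWithin] with t ht
        exact (if_neg ht).symm
      refine squeeze_zero (fun _ => norm_nonneg _) (fun p => ?_)
        (hB.comp (continuous_fst.tendsto ((0 : unitInterval), U)))
      by_cases hp : p.1 = 0
      · have : (F p).toCLM f = f := by simp only [F, if_pos hp]; rfl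
        simp [this, B, hp]
      · simpa only [F, B, Function.comp, if_neg hp] using norm_conjExtend_sub_le _ _ _ _
    · have hσ : ContinuousAt σ t :=
        (continuous_real_toNNReal.continuousAt).comp
          ((continuous_subtype_val.continuousAt.inv₀ (fun h => ht (Subtype.ext h))).sub
            continuousAt_const)
      have h1 : ContinuousAt (fun p : unitInterval × StrongUnitaryGroup H => (σ p.1, p.2)) (t, U) :=
        (ContinuousAt.comp (f := Prod.fst) (g := σ) (x := (t, U)) hσ continuousAt_fst).prodMk continuousAt_snd
      refine (hG.continuousAt.comp h1).congr ?_
      have : ∀ᶠ p : unitInterval × StrongUnitaryGroup H in 𝓝 (t, U), p.1 ≠ 0 :=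
        continuousAt_fst.eventually_ne ht
      filter_upwards [this] with p hp
      exact (if_neg hp).symm
  rw [contractible_iff_id_nullhomotopic]
  refine ⟨1, ⟨ContinuousMap.Homotopy.symm ⟨⟨F, hF⟩, fun U => ?_, fun U => ?_⟩⟩⟩
  · exact if_pos rfl
  · have h1 : σ 1 = 0 := by simp [σ]
    change F (1, U) = U
    simp only [F, one_ne_zero, if_false]
    have (s : ℝ≥0) (hs : s = 0) : conjExtend (W s) (hW s) U = U := by
      subst hs
      have (V : H →L[ℂ] H) (hV : star V * V = 1) (h : V = 1) : conjExtend V hV U = U := by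
        subst h; exact conjExtend_one hV U
      exact this _ _ h0
    exact this _ h1

end StrongUnitaryGroup

/-! ### Countable Hilbert bases -/

section HilbertDimension

variable {H : Type*} [NormedAddCommGroup H] [InnerProductSpace ℂ H]

theorem Orthonormal.countable_index [TopologicalSpace.SeparableSpace H] {ι : Type*} {v : ι → H}
    (hv : Orthonormal ℂ v) : Countable ι := by
  refine Pairwise.countable_of_isOpen_disjoint (s := fun i => Metric.ball (v i) (1 / 2)) ?_
    (fun _ => Metric.isOpen_ball) fun i => ⟨v i, Metric.mem_ball_self (by norm_num)⟩
  intro i j hij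
  refine Metric.ball_disjoint_ball ?_
  -- Distinct vectors are `√2 > 1` apart, so balls of radius `1 / 2` are disjoint.
  have h : ‖v i - v j‖ * ‖v i - v j‖ = 1 + 1 := by
    rw [norm_sub_mul_self (𝕜 := ℂ), hv.2 hij, hv.1, hv.1]; norm_num
  rw [dist_eq_norm]
  nlinarith [norm_nonneg (v i - v j)]

theorem HilbertBasis.finiteDimensional_of_finite {ι : Type*} [Finite ι] (b : HilbertBasis ι ℂ H) :
    FiniteDimensional ℂ H := by
  cases nonempty_fintype ι
  exact b.toOrthonormalBasis.toBasis.finiteDimensional_of_finite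

theorem exists_hilbertBasis_nat [CompleteSpace H] [TopologicalSpace.SeparableSpace H]
    (hH : ¬ FiniteDimensional ℂ H) : Nonempty (HilbertBasis ℕ ℂ H) := by
  obtain ⟨w, b, -⟩ := exists_hilbertBasis ℂ H
  have : Countable w := b.orthonormal.countable_index
  have : Infinite w := by
    rw [← not_finite_iff_infinite]
    exact fun _ => hH b.finiteDimensional_of_finite
  obtain ⟨e⟩ := nonempty_equiv_of_countable (α := ℕ) (β := w)
  refine ⟨HilbertBasis.mk (v := b ∘ e) (b.orthonormal.comp e e.injective) ?_⟩
  rw [e.surjective.range_comp, b.dense_span]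

end HilbertDimension

/-! ### Translations compressed to the half-line -/

namespace RealLineTranslation

/-- The Hilbert space of square-integrable complex functions on the real line. -/
abbrev LTwo : Type := Lp ℂ 2 (volume : Measure ℝ)

theorem measurePreserving_sub (s : ℝ) :
    MeasurePreserving (fun x : ℝ => x - s) volume volume :=
  measurePreserving_sub_right volume s

/-- Translation by `s`, taking `f` to `x ↦ f (x - s)`. -/
noncomputable def translate (s : ℝ) : LTwo →ₗᵢ[ℂ] LTwo :=
  Lp.compMeasurePreservingₗᵢ ℂ (fun x : ℝ => x - s) (measurePreserving_sub s)

theorem translate_ae (s : ℝ) (f : LTwo) : translate s f =ᵐ[volume] fun x => f (x - s) :=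
  Lp.coeFn_compMeasurePreserving f (measurePreserving_sub s)

theorem translate_translate (s t : ℝ) (f : LTwo) :
    translate s (translate t f) = translate (s + t) f := by
  refine Lp.ext ?_
  filter_upwards [translate_ae s (translate t f), translate_ae (s + t) f,
    (measurePreserving_sub s).quasiMeasurePreserving.ae (translate_ae t f)] with x h1 h2 h3
  rw [h1, h3, h2]; congr 1; ring

theorem translate_zero (f : LTwo) : translate 0 f = f := by
  refine Lp.ext ?_
  filter_upwards [translate_ae 0 f] with x hx
  rw [hx, sub_zero]

theorem continuous_translate (f : LTwo) : Continuous fun s => translate s f := by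
  let g : C(ℝ, C(ℝ, ℝ)) := (ContinuousMap.mk (fun p : ℝ × ℝ => p.2 - p.1) (by fun_prop)).curry
  exact (continuous_const (y := f)).compMeasurePreservingLp g.continuous measurePreserving_sub
    (by simp)

theorem inner_translate_left (s : ℝ) (f g : LTwo) :
    ⟪translate s f, g⟫_ℂ = ⟪f, translate (-s) g⟫_ℂ := by
  rw [← (translate (-s)).inner_map_map, translate_translate, neg_add_cancel, translate_zero]

/-- The functions vanishing almost everywhere to the right of `a`. -/
def supportedLeft (a : ℝ) : Submodule ℂ LTwo where
  carrier := {f | ∀ᵐ x, a < x → f x = 0}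
  zero_mem' := by
    filter_upwards [Lp.coeFn_zero ℂ 2 (volume : Measure ℝ)] with x hx _ using hx
  add_mem' {f g} hf hg := by
    filter_upwards [hf, hg, Lp.coeFn_add f g] with x h1 h2 h hx
    rw [h, Pi.add_apply, h1 hx, h2 hx, add_zero]
  smul_mem' c f hf := by
    filter_upwards [hf, Lp.coeFn_smul c f] with x h1 h hx
    rw [h, Pi.smul_apply, h1 hx, smul_zero]

theorem mem_supportedLeft {a : ℝ} {f : LTwo} :
    f ∈ supportedLeft a ↔ ∀ᵐ x, a < x → f x = 0 := Iff.rfl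

theorem supportedLeft_mono {a b : ℝ} (hab : a ≤ b) : supportedLeft a ≤ supportedLeft b := by
  intro f hf
  filter_upwards [mem_supportedLeft.1 hf] with x h hx using h (hab.trans_lt hx)

theorem translate_mem_supportedLeft {a s : ℝ} {f : LTwo} (hf : f ∈ supportedLeft a) :
    translate s f ∈ supportedLeft (a + s) := by
  filter_upwards [translate_ae s f,
    (measurePreserving_sub s).quasiMeasurePreserving.ae (mem_supportedLeft.1 hf)] with x h1 h2 hx
  rw [h1]; exact h2 (by linarith)

theorem dense_iUnion_supportedLeft : Dense {f : LTwo | ∃ a, f ∈ supportedLeft a} := by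
  refine (Lp.dense_hasCompactSupport_contDiff (F := ℂ) (μ := (volume : Measure ℝ)) (p := 2)
    (by simp)).mono ?_
  rintro f ⟨g, hfg, hg, -⟩
  obtain ⟨a, ha⟩ := hg.isCompact.bddAbove
  refine ⟨a, ?_⟩
  filter_upwards [hfg] with x hx hax
  rw [hx]
  exact image_eq_zero_of_notMem_tsupport fun h => hax.not_ge (ha h)

/-- The Hilbert space of square-integrable functions on the positive half-line, inside `L²(ℝ)`. -/
noncomputable def rightHalf : Submodule ℂ LTwo := (supportedLeft 0)ᗮ

instance : CompleteSpace rightHalf :=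
  inferInstanceAs (CompleteSpace ((supportedLeft 0)ᗮ : Submodule ℂ LTwo))

/-- The adjoint, translation by `-s`, preserves `supportedLeft 0`. -/
theorem translate_mem_rightHalf {s : ℝ} (hs : 0 ≤ s) {f : LTwo} (hf : f ∈ rightHalf) :
    translate s f ∈ rightHalf := by
  intro g hg
  have := inner_translate_left (-s) g f
  rw [neg_neg] at this
  rw [← this]
  exact hf _ (supportedLeft_mono (by linarith) (translate_mem_supportedLeft hg))

theorem rightHalf_ne_bot : rightHalf ≠ ⊥ := by
  have hm : volume (Set.Ioc (0 : ℝ) 1) ≠ ∞ := by simp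
  refine (Submodule.ne_bot_iff _).2 ⟨indicatorConstLp 2 measurableSet_Ioc hm (1 : ℂ), ?_, ?_⟩
  · intro g hg
    rw [← inner_conj_symm, L2.inner_indicatorConstLp_one, setIntegral_eq_zero_of_ae_eq_zero, map_zero]
    filter_upwards [mem_supportedLeft.1 hg] with x hx h using hx h.1
  · rw [← norm_ne_zero_iff, norm_indicatorConstLp (by simp) (by simp)]
    simp

section Compression

variable {H : Type*} [NormedAddCommGroup H] [InnerProductSpace ℂ H] [CompleteSpace H]
  (J : H →ₗᵢ[ℂ] LTwo)

/-- The compression `J* T J` of the translation `T` by `s` along the isometry `J`. -/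
noncomputable def compression (s : ℝ) : H →L[ℂ] H :=
  J.toContinuousLinearMap.adjoint ∘L (translate s).toContinuousLinearMap ∘L
    J.toContinuousLinearMap

theorem compression_apply (s : ℝ) (f : H) :
    compression J s f = J.toContinuousLinearMap.adjoint (translate s (J f)) := rfl

theorem adjoint_isometry_apply (f : H) : J.toContinuousLinearMap.adjoint (J f) = f :=
  ext_inner_right ℂ fun g => by
    rw [ContinuousLinearMap.adjoint_inner_left]; exact J.inner_map_map f g

theorem star_compression (s : ℝ) : star (compression J s) = compression J (-s) := by
  rw [ContinuousLinearMap.star_eq_adjoint, eq_comm, ContinuousLinearMap.eq_adjoint_iff]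
  intro f g
  rw [compression_apply, compression_apply, ContinuousLinearMap.adjoint_inner_left,
    ContinuousLinearMap.adjoint_inner_right]
  simpa using inner_translate_left (-s) (J f) (J g)

theorem continuous_compression (f : H) : Continuous fun s => compression J s f :=
  (J.toContinuousLinearMap.adjoint).continuous.comp (continuous_translate (J f))

theorem compression_zero : compression J 0 = 1 := by
  ext f
  rw [compression_apply, translate_zero, adjoint_isometry_apply]; rfl

/-- For `s ≥ 0` translation preserves the range of `J`, on which `J J*` is the identity. -/
theorem compression_neg_mul (hJ : ∀ f, f ∈ rightHalf ↔ ∃ h, J h = f) {s : ℝ} (hs : 0 ≤ s) :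
    compression J (-s) * compression J s = 1 := by
  ext f
  obtain ⟨h, hh⟩ := (hJ _).1 (translate_mem_rightHalf hs ((hJ _).2 ⟨f, rfl⟩))
  rw [mul_apply_eq_comp, compression_apply J s, ← hh, adjoint_isometry_apply,
    compression_apply, hh, translate_translate, neg_add_cancel, translate_zero,
    adjoint_isometry_apply]
  rfl

theorem tendsto_adjoint_translate (hJ : ∀ h, J h ∈ rightHalf) (f : LTwo) :
    Tendsto (fun s : ℝ => J.toContinuousLinearMap.adjoint (translate (-s) f)) atTop (𝓝 0) := by
  rw [Metric.tendsto_atTop]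
  intro ε hε
  -- Once `s ≥ a`, the translate of `g` is orthogonal to the range of `J`; the error `f - g` is
  -- never enlarged.
  obtain ⟨g, ⟨a, ha⟩, hg⟩ := dense_iUnion_supportedLeft.exists_dist_lt f hε
  refine ⟨a, fun s hs => ?_⟩
  have h0 : J.toContinuousLinearMap.adjoint (translate (-s) g) = 0 :=
    ext_inner_right ℂ fun h => by
      rw [ContinuousLinearMap.adjoint_inner_left, inner_zero_left]
      exact hJ h _ (supportedLeft_mono (by linarith) (translate_mem_supportedLeft ha))
  rw [dist_zero_right, ← sub_zero (J.toContinuousLinearMap.adjoint _), ← h0, ← map_sub, ← map_sub]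
  refine lt_of_le_of_lt (ContinuousLinearMap.le_opNorm _ _) ?_
  rw [LinearIsometry.norm_map, LinearIsometryEquiv.norm_map]
  refine lt_of_le_of_lt ?_ hg
  rw [dist_eq_norm]
  exact mul_le_of_le_one_left (norm_nonneg _) J.norm_toContinuousLinearMap_le

end Compression

/-- In finite dimension the injective right translations would be onto, so left translations would
preserve `rightHalf` and their compressions would preserve norms instead of tending to zero. -/
theorem rightHalf_not_finiteDimensional : ¬ FiniteDimensional ℂ rightHalf := by
  intro _
  refine rightHalf_ne_bot ((Submodule.eq_bot_iff _).2 fun f hf => ?_)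
  have key (s : ℝ) (hs : 0 ≤ s) : translate (-s) f ∈ rightHalf := by
    let T : rightHalf →ₗ[ℂ] rightHalf :=
      (translate s).toLinearMap.restrict fun g hg => translate_mem_rightHalf hs hg
    have hT : Function.Injective T := fun g h hgh =>
      Subtype.ext ((translate s).injective (congrArg Subtype.val hgh))
    obtain ⟨g, hg⟩ := LinearMap.injective_iff_surjective.1 hT ⟨f, hf⟩
    have hg' : translate s g = f := congrArg Subtype.val hg
    rw [← hg', translate_translate, neg_add_cancel, translate_zero]
    exact g.2
  have hlim := (tendsto_adjoint_translate rightHalf.subtypeₗᵢ (fun h => h.2) f).norm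
  have hconst : ∀ᶠ s : ℝ in atTop,
      ‖rightHalf.subtypeₗᵢ.toContinuousLinearMap.adjoint (translate (-s) f)‖ = ‖f‖ := by
    filter_upwards [eventually_ge_atTop 0] with s hs
    have := adjoint_isometry_apply rightHalf.subtypeₗᵢ ⟨_, key s hs⟩
    exact (congrArg norm this).trans ((translate (-s)).norm_map f)
  have := tendsto_nhds_unique (hlim.congr' hconst) tendsto_const_nhds
  simpa using this.symm

theorem exists_isometry_onto_rightHalf (H : Type*) [NormedAddCommGroup H] [InnerProductSpace ℂ H]
    [CompleteSpace H] [TopologicalSpace.SeparableSpace H] (hH : ¬ FiniteDimensional ℂ H) :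
    ∃ J : H →ₗᵢ[ℂ] LTwo, ∀ f, f ∈ rightHalf ↔ ∃ h, J h = f := by
  have : Fact ((2 : ℝ≥0∞) ≠ ∞) := ⟨by simp⟩
  obtain ⟨b⟩ := exists_hilbertBasis_nat hH
  obtain ⟨c⟩ := exists_hilbertBasis_nat rightHalf_not_finiteDimensional
  let e : H ≃ₗᵢ[ℂ] rightHalf := b.repr.trans c.repr.symm
  refine ⟨rightHalf.subtypeₗᵢ.comp e.toLinearIsometry, fun f => ⟨fun hf => ⟨e.symm ⟨f, hf⟩, ?_⟩, ?_⟩⟩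
  · simp
  · rintro ⟨h, rfl⟩
    exact (e h).2

end RealLineTranslation

theorem mainTheorem4 (H : Type*) [NormedAddCommGroup H] [InnerProductSpace ℂ H] [CompleteSpace H]
    [TopologicalSpace.SeparableSpace H] (hH : ¬ FiniteDimensional ℂ H) :
    ContractibleSpace (StrongUnitaryGroup H) := by
  obtain ⟨J, hJ⟩ := RealLineTranslation.exists_isometry_onto_rightHalf H hH
  refine StrongUnitaryGroup.contractibleSpace_of_isometries
    (fun s => RealLineTranslation.compression J s) (fun s => ?_)
    (RealLineTranslation.compression_zero J) (fun f => ?_) (fun f => ?_) (fun f => ?_)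
  · rw [RealLineTranslation.star_compression]
    exact RealLineTranslation.compression_neg_mul J hJ s.2
  · exact (RealLineTranslation.continuous_compression J f).comp NNReal.continuous_coe
  · simp only [RealLineTranslation.star_compression]
    exact (RealLineTranslation.continuous_compression J f).comp NNReal.continuous_coe.neg
  · simp only [RealLineTranslation.star_compression]
    exact (RealLineTranslation.tendsto_adjoint_translate J (fun h => (hJ _).2 ⟨h, rfl⟩) (J f)).comp
      (NNReal.tendsto_coe_atTop.2 tendsto_id)
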